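/- **Theorem 4.** Let $n,m\ge 2$ be integers. Let $g_0$ denote both semi-Euclidean metrics $(g_0)_{ij}=\epsilon_i\delta_{ij}$ on $\mathbb{R}^n$ ($\epsilon_i=\pm1$) and $(g_0)_{ij}=\epsilon'_i\delta_{ij}$ on $\mathbb{R}^m$ ($\epsilon'_i=\pm1$). Fix nonzero vectors $\alpha\in\mathbb{R}^n$, $\beta\in\mathbb{R}^m$, put $$\xi(x)=\sum_{i=1}^n\alpha_ix_i,\qquad \zeta(y)=\sum_{j=1}^m\beta_jy_j,\qquad \|\alpha\|^2=\sum_i\epsilon_i\alpha_i^2,\qquad \|\beta\|^2=\sum_j\epsilon'_j\beta_j^2 ,$$ and let $\theta\ge 0$, $\lambda\in\mathbb{R}$. Let $\varphi,f,h,\tau,u:\mathbb{R}\to\mathbb{R}$ be smooth functions with $\varphi$ and $\tau$ nowhere zero and $f>0$. On $\mathbb{R}^n\times\mathbb{R}^m$, with projections $\pi$ and $\sigma$ onto the two factors, consider the warped product metric with base $(\mathbb{R}^n,(\varphi\circ\xi)^{-2}g_0)$, fiber $(\mathbb{R}^m,(\tau\circ\zeta)^{-2}g_0)$ and warping function $f\circ\xi$,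 $$g=\pi^*\big((\varphi\circ\xi)^{-2}g_0\big)+(f\circ\xi\circ\pi)^2\,\sigma^*\big((\tau\circ\zeta)^{-2}g_0\big),$$ the potential $H=h\circ\xi\circ\pi$ and the real-valued map $U=u\circ\zeta\circ\sigma$. Then $U$ is non-constant and $(\mathbb{R}^n\times\mathbb{R}^m,g,H,U,\lambda)$ is a gradient Ricci-harmonic soliton with constant $\theta$, that is, $$\mathrm{Ric}_g+\mathrm{Hess}_g H-\theta\,\nabla U\otimes\nabla U=\lambda g,\qquad \mathrm{tr}_g(\nabla dU)-g(\nabla U,\nabla H)=0,$$ if and only if $u$ is non-constant and, for all $\xi,\zeta\in\mathbb{R}$, with $\varphi,f,h$ evaluated at $\xi$ and $\tau,u$ evaluated at $\zeta$, $$(n-2)\frac{\varphi''}{\varphi}-m\frac{f''}{f}-2m\frac{\varphi'}{\varphi}\frac{f'}{f}+h''+2\frac{\varphi'}{\varphi}h'=0,$$ $$\Big[\frac{\varphi''}{\varphi}-(n-1)\Big(\frac{\varphi'}{\varphi}\Big)^2+m\frac{\varphi'}{\varphi}\frac{f'}{f}-\frac{\varphi'}{\varphi}h'\Big]\|\alpha\|^2=\frac{\lambda}{\varphi^2},$$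 $$\big[f''\varphi^2f-(n-2)\varphi'\varphi ff'+(m-1)(f')^2\varphi^2-f'f\varphi^2h'\big]\|\alpha\|^2+\lambda f^2=\big[\tau\tau''-(m-1)(\tau')^2\big]\|\beta\|^2,$$ $$(m-2)\frac{\tau''}{\tau}-\theta(u')^2=0,$$ $$\big[\tau^2u''-(m-2)\tau\tau'u'\big]\|\beta\|^2=0.$$ -/

import Mathlib

open scoped ContDiff

noncomputable section

/-! Semi-Riemannian geometry in global coordinates. A point of the coordinate space is a function
`x : ι → ℝ`, and a metric is given by its matrix of components `g x` at each point `x`. -/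

namespace GRHS

section Coordinates

variable {ι : Type*} [Fintype ι] [DecidableEq ι]

/-- The partial derivative `∂F/∂xᵢ` at `x`. -/
def partialDeriv (i : ι) (F : (ι → ℝ) → ℝ) (x : ι → ℝ) : ℝ :=
  fderiv ℝ F x (Pi.single i 1)

/-- A semi-Riemannian metric on `ℝ^ι`: a smooth field of symmetric nondegenerate bilinear forms
(the index is then constant, since `ℝ^ι` is connected). -/
structure IsSemiRiemannianMetric (g : (ι → ℝ) → Matrix ι ι ℝ) : Prop where
  smooth : ∀ i j, ContDiff ℝ ∞ (fun x => g x i j)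
  symm : ∀ x, (g x).IsSymm
  nondegenerate : ∀ x, IsUnit (g x).det

/-- Christoffel symbols `Γᵏᵢⱼ = ½ ∑ₗ gᵏˡ (∂ᵢ gⱼₗ + ∂ⱼ gᵢₗ - ∂ₗ gᵢⱼ)` of the Levi-Civita
connection. -/
def christoffel (g : (ι → ℝ) → Matrix ι ι ℝ) (k i j : ι) (x : ι → ℝ) : ℝ :=
  (1 / 2 : ℝ) * ∑ l, (g x)⁻¹ k l *
    (partialDeriv i (fun y => g y j l) x + partialDeriv j (fun y => g y i l) x
      - partialDeriv l (fun y => g y i j) x)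

/-- Components of the curvature tensor, `R(∂ᵢ, ∂ⱼ) ∂ₖ = ∑ₗ Rˡₖᵢⱼ ∂ₗ` with
`R(X, Y) = ∇_X ∇_Y - ∇_Y ∇_X - ∇_[X,Y]`. -/
def riemann (g : (ι → ℝ) → Matrix ι ι ℝ) (l k i j : ι) (x : ι → ℝ) : ℝ :=
  partialDeriv i (christoffel g l j k) x - partialDeriv j (christoffel g l i k) x
    + ∑ p, (christoffel g l i p x * christoffel g p j k x
        - christoffel g l j p x * christoffel g p i k x)

/-- The Ricci tensor `Ric(∂ⱼ, ∂ₖ) = tr (X ↦ R(X, ∂ⱼ) ∂ₖ)` (positive on round spheres). -/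
def ricci (g : (ι → ℝ) → Matrix ι ι ℝ) (j k : ι) (x : ι → ℝ) : ℝ :=
  ∑ i, riemann g i k i j x

/-- The Hessian `∇dF` of a function. -/
def hess (g : (ι → ℝ) → Matrix ι ι ℝ) (F : (ι → ℝ) → ℝ) (i j : ι) (x : ι → ℝ) : ℝ :=
  partialDeriv i (partialDeriv j F) x - ∑ k, christoffel g k i j x * partialDeriv k F x

/-- The tension field `tr_g (∇du)` of a real-valued map. -/
def tension (g : (ι → ℝ) → Matrix ι ι ℝ) (u : (ι → ℝ) → ℝ) (x : ι → ℝ) : ℝ :=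
  ∑ i, ∑ j, (g x)⁻¹ i j * hess g u i j x

/-- The gradient vector field `(∇F)ⁱ = ∑ⱼ gⁱʲ ∂ⱼF`. -/
def grad (g : (ι → ℝ) → Matrix ι ι ℝ) (F : (ι → ℝ) → ℝ) (x : ι → ℝ) : ι → ℝ :=
  fun i => ∑ j, (g x)⁻¹ i j * partialDeriv j F x

/-- The scalar product `g(X, Y)` of two tangent vectors at `x`. -/
def metricInner (g : (ι → ℝ) → Matrix ι ι ℝ) (x : ι → ℝ) (X Y : ι → ℝ) : ℝ :=
  ∑ i, ∑ j, g x i j * X i * Y j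

/-- Gradient Ricci-harmonic soliton on `(ℝ^ι, g)` with a real-valued harmonic map `u`, potential
`h` and constants `θ ≥ 0`, `lam`:
`Ric + Hess h - θ ∇u ⊗ ∇u = lam g` and `τ_g u = g(∇u, ∇h)`.
Here `∇u ⊗ ∇u` is the covariant 2-tensor with components `∂ᵢu ∂ⱼu`. -/
structure IsGRHS (g : (ι → ℝ) → Matrix ι ι ℝ) (h u : (ι → ℝ) → ℝ) (θ lam : ℝ) : Prop where
  metric : IsSemiRiemannianMetric g
  smooth_potential : ContDiff ℝ ∞ h
  smooth_map : ContDiff ℝ ∞ u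
  theta_nonneg : 0 ≤ θ
  ricci_eq : ∀ x i j,
    ricci g i j x + hess g h i j x - θ * (partialDeriv i u x * partialDeriv j u x)
      = lam * g x i j
  tension_eq : ∀ x, tension g u x - metricInner g x (grad g u x) (grad g h x) = 0

/-- The linear function `x ↦ ∑ᵢ aᵢ xᵢ`, invariant under a codimension one translation group. -/
def linFun (a x : ι → ℝ) : ℝ := ∑ i, a i * x i

/-- `‖a‖² = ∑ᵢ εᵢ aᵢ²`, with respect to the semi-Euclidean metric of signature `ε`. -/
def sqNorm (ε a : ι → ℝ) : ℝ := ∑ i, ε i * a i ^ 2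

/-- The metric `ψ⁻² g₀` conformal to the semi-Euclidean metric `(g₀)ᵢⱼ = εᵢ δᵢⱼ`. -/
def conformalMetric (ε : ι → ℝ) (ψ : (ι → ℝ) → ℝ) (x : ι → ℝ) : Matrix ι ι ℝ :=
  ((ψ x) ^ 2)⁻¹ • Matrix.diagonal ε

end Coordinates

section Warped

variable {ι κ : Type*}

/-- The projection `π : B × F → B`. -/
def baseProj (p : ι ⊕ κ → ℝ) : ι → ℝ := fun i => p (Sum.inl i)

/-- The projection `σ : B × F → F`. -/
def fiberProj (p : ι ⊕ κ → ℝ) : κ → ℝ := fun j => p (Sum.inr j)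

/-- The warped product metric `π^* g_B + (f ∘ π)² σ^* g_F` on `ℝ^ι × ℝ^κ = ℝ^(ι ⊕ κ)`. -/
def warpedMetric (gB : (ι → ℝ) → Matrix ι ι ℝ) (f : (ι → ℝ) → ℝ)
    (gF : (κ → ℝ) → Matrix κ κ ℝ) (p : ι ⊕ κ → ℝ) : Matrix (ι ⊕ κ) (ι ⊕ κ) ℝ :=
  Matrix.fromBlocks (gB (baseProj p)) 0 0 ((f (baseProj p)) ^ 2 • gF (fiberProj p))

end Warped

end GRHS

end

/-! Write s = ξ(x), t = ζ(y). Each component of the metric is a constant times a function of s times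
a function of t, and the Christoffel symbols inherit this shape. On a factor with conformal factor
ψ⁻², ψ depending on one linear coordinate with covector a, they are -(ψ'/ψ) K with K the constant
tensor `conformalSymbol`. So curvature and Hessians need only three contractions of K, each built
from a, a ⊗ a and ‖a‖² times the flat metric. Warping adds the terms in f'/f.

Substituting these into the soliton tensor Ric + Hess H - θ dU ⊗ dU - λg leaves three kinds of
blocks. The mixed block vanishes identically. The base block has the form A(s) α ⊗ α + B(s) ε, the
fiber block A(t) β ⊗ β + B(s,t) δ (`soliton_inl_inl`, `soliton_inr_inr`). In dimension at least two
a rank one form is independent of a nondegenerate one, so each block vanishes exactly when its two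
coefficients do (`mul_add_ite_eq_zero_iff`). This yields the first four equations; null α or β cause
no trouble, because only α, β ≠ 0 is used. As the linear coordinates are onto ℝ, independently of
each other, pointwise identities become identities in all s and t.

For the map equation, ∇U and ∇H are tangent to different factors, hence orthogonal, and the tension
field is the left side of the fifth equation divided by f² (`tension_comp_fiber`).

Throughout, `inl` marks base indices and `inr` fiber indices. -/

noncomputable section

set_option linter.unusedSectionVars false

namespace GRHS

/-- The constant tensor `Kᵏᵢⱼ` to which the Christoffel symbols of a metric conformal to a
semi-Euclidean one are proportional, when the conformal factor depends only on `linFun a`. -/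
def conformalSymbol {ι : Type*} [DecidableEq ι] (ε a : ι → ℝ) (k i j : ι) : ℝ :=
  (if j = k then a i else 0) + (if i = k then a j else 0) - (if i = j then ε k * ε i * a k else 0)

lemma conformalSymbol_comm {ι : Type*} [DecidableEq ι] (ε a : ι → ℝ) (k i j : ι) :
    conformalSymbol ε a k i j = conformalSymbol ε a k j i := by
  unfold conformalSymbol
  by_cases h : i = j
  · subst h; ring
  · rw [if_neg h, if_neg (Ne.symm h)]; ring

/-! ### Contractions of the constant tensor K -/

section Contractions

variable {ι : Type*} [Fintype ι] [DecidableEq ι] (ε a : ι → ℝ)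

lemma sum_mul_conformalSymbol (i j : ι) :
    ∑ k, a k * conformalSymbol ε a k i j
      = 2 * (a i * a j) - (if i = j then ε i * sqNorm ε a else 0) := by
  have h : ∀ k, a k * (if i = j then ε k * ε i * a k else 0)
      = (if i = j then ε i else 0) * (ε k * a k ^ 2) := by
    intro k; split_ifs <;> ring
  simp only [conformalSymbol, mul_sub, mul_add, Finset.sum_sub_distrib, Finset.sum_add_distrib, h,
    ← Finset.mul_sum, mul_ite, mul_zero, Finset.sum_ite_eq, Finset.mem_univ, if_true, sqNorm]
  split_ifs <;> ring

lemma sum_conformalSymbol_self (hε : ∀ i, ε i * ε i = 1) (j : ι) :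
    ∑ i, conformalSymbol ε a i i j = Fintype.card ι * a j := by
  simp only [conformalSymbol, Finset.sum_sub_distrib, Finset.sum_add_distrib, hε, one_mul]
  simp [Finset.card_univ]

/-- This is the quadratic term ΓΓ of the Ricci tensor. Expanding only the first factor into its
three deltas collapses the sum over p and leaves the two simpler contractions plus one explicit
remainder. -/
lemma sum_conformalSymbol_mul (hε : ∀ i, ε i * ε i = 1) (j k : ι) :
    ∑ i, ∑ p, conformalSymbol ε a i j p * conformalSymbol ε a p i k
      = (Fintype.card ι + 2) * (a j * a k) - 2 * (if j = k then ε j * sqNorm ε a else 0) := by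
  have inner : ∀ i, ∑ p, conformalSymbol ε a i j p * conformalSymbol ε a p i k
      = a j * conformalSymbol ε a i i k
        + (if j = i then ∑ p, a p * conformalSymbol ε a p i k else 0)
        - ε i * ε j * a i * conformalSymbol ε a j i k := by
    intro i
    have : ∀ p, conformalSymbol ε a i j p * conformalSymbol ε a p i k
        = (if p = i then a j * conformalSymbol ε a p i k else 0)
          + (if j = i then a p * conformalSymbol ε a p i k else 0)
          - (if j = p then ε i * ε j * a i * conformalSymbol ε a p i k else 0) := by
      intro p
      rw [conformalSymbol]
      split_ifs <;> ring
    rw [Finset.sum_congr rfl fun p _ => this p]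
    rw [Finset.sum_sub_distrib, Finset.sum_add_distrib]
    congr 1
    · congr 1
      · simp
      · split_ifs <;> simp
    · simp
  have last : ∀ i, ε i * ε j * a i * conformalSymbol ε a j i k
      = (if k = j then ε j * (ε i * a i ^ 2) else 0) + (if i = j then a i * a k else 0)
        - (if i = k then a i * a j else 0) := by
    intro i
    rw [conformalSymbol, mul_sub, mul_add]
    congr 1
    · congr 1
      · split_ifs <;> ring
      · split_ifs with h
        · subst h; linear_combination (a i * a k) * hε i
        · ring
    · split_ifs
      · linear_combination (a i * a j * (ε i * ε i)) * hε j + (a i * a j) * hε i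
      · ring
  simp only [inner, sum_mul_conformalSymbol, Finset.sum_sub_distrib, Finset.sum_add_distrib,
    ← Finset.mul_sum, sum_conformalSymbol_self ε a hε, last]
  simp only [Finset.sum_ite_eq, Finset.sum_ite_eq', Finset.mem_univ, if_true]
  by_cases h : j = k
  · subst h
    simp only [if_true, sqNorm, ← Finset.mul_sum]
    ring
  · simp only [if_neg h, if_neg (Ne.symm h), Finset.sum_const_zero]
    ring

end Contractions

/-! ### Derivatives of products F(ξ) G(ζ) -/

section PartialDerivatives

variable {ι κ : Type*} [Fintype ι] [Fintype κ]

lemma hasFDerivAt_comp_linFun_baseProj (a : ι → ℝ) {F : ℝ → ℝ} (hF : Differentiable ℝ F)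
    (p : ι ⊕ κ → ℝ) :
    HasFDerivAt (fun p : ι ⊕ κ → ℝ => F (linFun a (baseProj p)))
      (deriv F (linFun a (baseProj p)) •
        ∑ i, a i • ContinuousLinearMap.proj (R := ℝ) (φ := fun _ : ι ⊕ κ => ℝ) (Sum.inl i)) p := by
  refine (hF _).hasDerivAt.comp_hasFDerivAt p ?_
  exact HasFDerivAt.fun_sum fun i _ => (hasFDerivAt_apply (Sum.inl i) p).const_mul (a i)

lemma hasFDerivAt_comp_linFun_fiberProj (b : κ → ℝ) {F : ℝ → ℝ} (hF : Differentiable ℝ F)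
    (p : ι ⊕ κ → ℝ) :
    HasFDerivAt (fun p : ι ⊕ κ → ℝ => F (linFun b (fiberProj p)))
      (deriv F (linFun b (fiberProj p)) •
        ∑ j, b j • ContinuousLinearMap.proj (R := ℝ) (φ := fun _ : ι ⊕ κ => ℝ) (Sum.inr j)) p := by
  refine (hF _).hasDerivAt.comp_hasFDerivAt p ?_
  exact HasFDerivAt.fun_sum fun j _ => (hasFDerivAt_apply (Sum.inr j) p).const_mul (b j)

variable [DecidableEq ι] [DecidableEq κ] (a : ι → ℝ) (b : κ → ℝ) {F G : ℝ → ℝ}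

/-- The shape constant × F(s) × G(t) covers every component differentiated below; the one-factor
versions follow by taking the other function to be 1. -/
lemma partialDeriv_inl_mul (hF : Differentiable ℝ F) (hG : Differentiable ℝ G) (i : ι) (C : ℝ)
    (p : ι ⊕ κ → ℝ) :
    partialDeriv (Sum.inl i)
      (fun p : ι ⊕ κ → ℝ => C * (F (linFun a (baseProj p)) * G (linFun b (fiberProj p)))) p
      = C * (a i * deriv F (linFun a (baseProj p)) * G (linFun b (fiberProj p))) := by
  rw [partialDeriv, (((hasFDerivAt_comp_linFun_baseProj a hF p).fun_mul
    (hasFDerivAt_comp_linFun_fiberProj b hG p)).const_mul C).fderiv]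
  simp [Pi.single_apply]
  left
  ring

lemma partialDeriv_inr_mul (hF : Differentiable ℝ F) (hG : Differentiable ℝ G) (j : κ) (C : ℝ)
    (p : ι ⊕ κ → ℝ) :
    partialDeriv (Sum.inr j)
      (fun p : ι ⊕ κ → ℝ => C * (F (linFun a (baseProj p)) * G (linFun b (fiberProj p)))) p
      = C * (b j * F (linFun a (baseProj p)) * deriv G (linFun b (fiberProj p))) := by
  rw [partialDeriv, (((hasFDerivAt_comp_linFun_baseProj a hF p).fun_mul
    (hasFDerivAt_comp_linFun_fiberProj b hG p)).const_mul C).fderiv]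
  simp [Pi.single_apply]
  left
  ring

lemma partialDeriv_const {ι : Type*} [Fintype ι] [DecidableEq ι] (i : ι) (C : ℝ) (x : ι → ℝ) :
    partialDeriv i (fun _ => C) x = 0 := by
  simp [partialDeriv]

lemma partialDeriv_inl_base (hF : Differentiable ℝ F) (i : ι) (C : ℝ) (p : ι ⊕ κ → ℝ) :
    partialDeriv (Sum.inl i) (fun p : ι ⊕ κ → ℝ => C * F (linFun a (baseProj p))) p
      = C * (a i * deriv F (linFun a (baseProj p))) := by
  simpa using partialDeriv_inl_mul a (0 : κ → ℝ) (G := fun _ => 1) hF (by fun_prop) i C p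

lemma partialDeriv_inr_base (hF : Differentiable ℝ F) (j : κ) (C : ℝ) (p : ι ⊕ κ → ℝ) :
    partialDeriv (Sum.inr j) (fun p : ι ⊕ κ → ℝ => C * F (linFun a (baseProj p))) p = 0 := by
  simpa using partialDeriv_inr_mul a (0 : κ → ℝ) (G := fun _ => 1) hF (by fun_prop) j C p

lemma partialDeriv_inl_fiber (hG : Differentiable ℝ G) (i : ι) (C : ℝ) (p : ι ⊕ κ → ℝ) :
    partialDeriv (Sum.inl i) (fun p : ι ⊕ κ → ℝ => C * G (linFun b (fiberProj p))) p = 0 := by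
  simpa using partialDeriv_inl_mul (0 : ι → ℝ) b (F := fun _ => 1) (by fun_prop) hG i C p

lemma partialDeriv_inr_fiber (hG : Differentiable ℝ G) (j : κ) (C : ℝ) (p : ι ⊕ κ → ℝ) :
    partialDeriv (Sum.inr j) (fun p : ι ⊕ κ → ℝ => C * G (linFun b (fiberProj p))) p
      = C * (b j * deriv G (linFun b (fiberProj p))) := by
  simpa using partialDeriv_inr_mul (0 : ι → ℝ) b (F := fun _ => 1) (by fun_prop) hG j C p

end PartialDerivatives

/-! ### Inverse metric and Christoffel symbols -/

section Connection

variable {ι κ : Type*} [DecidableEq ι] [DecidableEq κ] [Fintype ι] [Fintype κ]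

/-- The warped product of two conformally semi-Euclidean spaces whose conformal factors and
warping function are functions of one linear coordinate. -/
abbrev translationMetric (ε α : ι → ℝ) (δ β : κ → ℝ) (φ f τ : ℝ → ℝ) :
    (ι ⊕ κ → ℝ) → Matrix (ι ⊕ κ) (ι ⊕ κ) ℝ :=
  warpedMetric (conformalMetric ε (fun x => φ (linFun α x))) (fun x => f (linFun α x))
    (conformalMetric δ (fun y => τ (linFun β y)))

variable (ε α : ι → ℝ) (δ β : κ → ℝ) (φ f τ : ℝ → ℝ)

local notation "𝔤" => translationMetric ε α δ β φ f τ

lemma translationMetric_inl_inl (p : ι ⊕ κ → ℝ) (i j : ι) :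
    𝔤 p (Sum.inl i) (Sum.inl j)
      = (if i = j then ε i else 0) * (φ (linFun α (baseProj p)) ^ 2)⁻¹ := by
  simp [warpedMetric, conformalMetric, Matrix.diagonal_apply, mul_comm]

lemma translationMetric_inl_inr (p : ι ⊕ κ → ℝ) (i : ι) (j : κ) :
    𝔤 p (Sum.inl i) (Sum.inr j) = 0 := by
  simp [warpedMetric]

lemma translationMetric_inr_inl (p : ι ⊕ κ → ℝ) (i : κ) (j : ι) :
    𝔤 p (Sum.inr i) (Sum.inl j) = 0 := by
  simp [warpedMetric]

lemma translationMetric_inr_inr (p : ι ⊕ κ → ℝ) (i j : κ) :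
    𝔤 p (Sum.inr i) (Sum.inr j) = (if i = j then δ i else 0)
      * (f (linFun α (baseProj p)) ^ 2 * (τ (linFun β (fiberProj p)) ^ 2)⁻¹) := by
  simp [warpedMetric, conformalMetric, Matrix.diagonal_apply]
  ring_nf

variable {ε δ φ f τ} (hε : ∀ i, ε i * ε i = 1) (hδ : ∀ i, δ i * δ i = 1)
  (hφ0 : ∀ s, φ s ≠ 0) (hf0 : ∀ s, f s ≠ 0) (hτ0 : ∀ s, τ s ≠ 0)

include hε hδ hφ0 hf0 hτ0

/-- The metric is diagonal, and each sign is its own inverse because its square is 1. -/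
lemma translationMetric_mul_inverse (p : ι ⊕ κ → ℝ) :
    𝔤 p * Matrix.diagonal (Sum.elim (fun i => ε i * φ (linFun α (baseProj p)) ^ 2)
      (fun j => δ j * ((f (linFun α (baseProj p)) ^ 2)⁻¹ * τ (linFun β (fiberProj p)) ^ 2))) = 1 := by
  have h1 := hφ0 (linFun α (baseProj p))
  have h2 := hf0 (linFun α (baseProj p))
  have h3 := hτ0 (linFun β (fiberProj p))
  ext A B
  rw [Matrix.mul_diagonal]
  rcases A with i | i <;> rcases B with j | j
  · rw [translationMetric_inl_inl, Matrix.one_apply]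
    by_cases h : i = j
    · subst h
      simp only [if_true, Sum.elim_inl]
      field_simp
      linear_combination hε i
    · simp [h]
  · simp [translationMetric_inl_inr]
  · simp [translationMetric_inr_inl]
  · rw [translationMetric_inr_inr, Matrix.one_apply]
    by_cases h : i = j
    · subst h
      simp only [if_true, Sum.elim_inr]
      field_simp
      linear_combination hδ i
    · simp [h]

lemma translationMetric_inv (p : ι ⊕ κ → ℝ) :
    (𝔤 p)⁻¹ = Matrix.diagonal (Sum.elim (fun i => ε i * φ (linFun α (baseProj p)) ^ 2)
      (fun j => δ j * ((f (linFun α (baseProj p)) ^ 2)⁻¹ * τ (linFun β (fiberProj p)) ^ 2))) :=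
  Matrix.inv_eq_right_inv (translationMetric_mul_inverse α β hε hδ hφ0 hf0 hτ0 p)

omit hε hδ hφ0 hf0 hτ0

lemma partialDeriv_translationMetric_inl_inr (p : ι ⊕ κ → ℝ) (A : ι ⊕ κ) (i : ι) (j : κ) :
    partialDeriv A (fun y => 𝔤 y (Sum.inl i) (Sum.inr j)) p = 0 := by
  simp only [translationMetric_inl_inr, partialDeriv_const]

lemma partialDeriv_translationMetric_inr_inl (p : ι ⊕ κ → ℝ) (A : ι ⊕ κ) (i : κ) (j : ι) :
    partialDeriv A (fun y => 𝔤 y (Sum.inr i) (Sum.inl j)) p = 0 := by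
  simp only [translationMetric_inr_inl, partialDeriv_const]

lemma deriv_inv_sq {F : ℝ → ℝ} (hF : Differentiable ℝ F) {s : ℝ} (h0 : F s ≠ 0) :
    deriv (fun s => (F s ^ 2)⁻¹) s = -2 * logDeriv F s * (F s ^ 2)⁻¹ := by
  rw [((hF s).hasDerivAt.fun_pow 2 |>.fun_inv (pow_ne_zero 2 h0)).deriv, logDeriv_apply]
  field_simp
  simp
  ring

lemma differentiable_inv_sq {F : ℝ → ℝ} (hF : Differentiable ℝ F) (h0 : ∀ s, F s ≠ 0) :
    Differentiable ℝ (fun s => (F s ^ 2)⁻¹) :=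
  (hF.fun_pow 2).fun_inv fun s => pow_ne_zero 2 (h0 s)

/-- No nonvanishing is needed: at a zero of F both sides are 0. -/
lemma deriv_sq {F : ℝ → ℝ} (hF : Differentiable ℝ F) (s : ℝ) :
    deriv (fun s => F s ^ 2) s = 2 * logDeriv F s * F s ^ 2 := by
  rw [((hF s).hasDerivAt.fun_pow 2).deriv, logDeriv_apply]
  field_simp
  simp
  ring

variable (hφ : Differentiable ℝ φ) (hf : Differentiable ℝ f) (hτ : Differentiable ℝ τ)

include hφ hφ0 in
lemma partialDeriv_inl_translationMetric_inl_inl (p : ι ⊕ κ → ℝ) (k i j : ι) :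
    partialDeriv (Sum.inl k) (fun y => 𝔤 y (Sum.inl i) (Sum.inl j)) p
      = (if i = j then ε i else 0) * (α k * (-2 * logDeriv φ (linFun α (baseProj p))
        * (φ (linFun α (baseProj p)) ^ 2)⁻¹)) := by
  simp only [translationMetric_inl_inl]
  rw [partialDeriv_inl_base α (differentiable_inv_sq hφ hφ0), deriv_inv_sq hφ (hφ0 _)]

include hφ hφ0 in
lemma partialDeriv_inr_translationMetric_inl_inl (p : ι ⊕ κ → ℝ) (k : κ) (i j : ι) :
    partialDeriv (Sum.inr k) (fun y => 𝔤 y (Sum.inl i) (Sum.inl j)) p = 0 := by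
  simp only [translationMetric_inl_inl]
  rw [partialDeriv_inr_base α (differentiable_inv_sq hφ hφ0)]

include hf hτ hτ0 in
lemma partialDeriv_inl_translationMetric_inr_inr (p : ι ⊕ κ → ℝ) (k : ι) (i j : κ) :
    partialDeriv (Sum.inl k) (fun y => 𝔤 y (Sum.inr i) (Sum.inr j)) p
      = (if i = j then δ i else 0) * (α k * (2 * logDeriv f (linFun α (baseProj p))
        * f (linFun α (baseProj p)) ^ 2) * (τ (linFun β (fiberProj p)) ^ 2)⁻¹) := by
  simp only [translationMetric_inr_inr]
  rw [partialDeriv_inl_mul α β (hf.fun_pow 2) (differentiable_inv_sq hτ hτ0), deriv_sq hf]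

include hf hτ hτ0 in
lemma partialDeriv_inr_translationMetric_inr_inr (p : ι ⊕ κ → ℝ) (k : κ) (i j : κ) :
    partialDeriv (Sum.inr k) (fun y => 𝔤 y (Sum.inr i) (Sum.inr j)) p
      = (if i = j then δ i else 0) * (β k * f (linFun α (baseProj p)) ^ 2 *
        (-2 * logDeriv τ (linFun β (fiberProj p)) * (τ (linFun β (fiberProj p)) ^ 2)⁻¹)) := by
  simp only [translationMetric_inr_inr]
  rw [partialDeriv_inr_mul α β (hf.fun_pow 2) (differentiable_inv_sq hτ hτ0), deriv_inv_sq hτ (hτ0 _)]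

include hε hδ hφ0 hf0 hτ0

/-- The inverse metric is diagonal, so a single term of the contraction over l survives. -/
lemma christoffel_inl (k : ι) (A B : ι ⊕ κ) (p : ι ⊕ κ → ℝ) :
    christoffel 𝔤 (Sum.inl k) A B p = (1 / 2 : ℝ) * (ε k * φ (linFun α (baseProj p)) ^ 2) *
      (partialDeriv A (fun y => 𝔤 y B (Sum.inl k)) p + partialDeriv B (fun y => 𝔤 y A (Sum.inl k)) p
        - partialDeriv (Sum.inl k) (fun y => 𝔤 y A B) p) := by
  rw [christoffel, Fintype.sum_eq_single (Sum.inl k), translationMetric_inv α β hε hδ hφ0 hf0 hτ0,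
    Matrix.diagonal_apply_eq, Sum.elim_inl]
  · ring
  intro l hl
  rw [translationMetric_inv α β hε hδ hφ0 hf0 hτ0, Matrix.diagonal_apply_ne' _ hl, zero_mul]

lemma christoffel_inr (k : κ) (A B : ι ⊕ κ) (p : ι ⊕ κ → ℝ) :
    christoffel 𝔤 (Sum.inr k) A B p = (1 / 2 : ℝ) * (δ k *
        ((f (linFun α (baseProj p)) ^ 2)⁻¹ * τ (linFun β (fiberProj p)) ^ 2)) *
      (partialDeriv A (fun y => 𝔤 y B (Sum.inr k)) p + partialDeriv B (fun y => 𝔤 y A (Sum.inr k)) p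
        - partialDeriv (Sum.inr k) (fun y => 𝔤 y A B) p) := by
  rw [christoffel, Fintype.sum_eq_single (Sum.inr k), translationMetric_inv α β hε hδ hφ0 hf0 hτ0,
    Matrix.diagonal_apply_eq, Sum.elim_inr]
  · ring
  intro l hl
  rw [translationMetric_inv α β hε hδ hφ0 hf0 hτ0, Matrix.diagonal_apply_ne' _ hl, zero_mul]

include hφ hf hτ

lemma christoffel_inl_inl_inl (k i j : ι) :
    christoffel 𝔤 (Sum.inl k) (Sum.inl i) (Sum.inl j)
      = fun p => -conformalSymbol ε α k i j * logDeriv φ (linFun α (baseProj p)) := by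
  funext p
  have h0 : φ (linFun α (baseProj p)) ^ 2 * (φ (linFun α (baseProj p)) ^ 2)⁻¹ = 1 :=
    mul_inv_cancel₀ (pow_ne_zero 2 (hφ0 _))
  rw [christoffel_inl α β hε hδ hφ0 hf0 hτ0, conformalSymbol]
  simp only [partialDeriv_inl_translationMetric_inl_inl α β hφ0 hφ]
  -- Each conditional is rewritten as a 0/1 indicator times its value, with the sign always taken at
  -- k, so that the identity becomes polynomial in the indicators.
  have e1 : ∀ l, (if l = k then ε l else 0) = (if l = k then 1 else 0) * ε k := by
    intro l; split_ifs with h <;> simp [h]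
  have e2 : ∀ (l m : ι) (x : ℝ), (if l = m then x else 0) = (if l = m then 1 else 0) * x := by simp
  rw [e1, e1, e2 i j (ε i), e2 j k (α i), e2 i k (α j), e2 i j (ε k * ε i * α k)]
  linear_combination
    (-logDeriv φ (linFun α (baseProj p)) * ε k * ((if j = k then 1 else 0) * ε k * α i
      + (if i = k then 1 else 0) * ε k * α j - (if i = j then 1 else 0) * ε i * α k)) * h0
    - logDeriv φ (linFun α (baseProj p)) * ((if j = k then 1 else 0) * α i + (if i = k then 1 else 0) * α j) * hε k

lemma christoffel_inl_inl_inr (k i : ι) (j : κ) :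
    christoffel 𝔤 (Sum.inl k) (Sum.inl i) (Sum.inr j) = fun _ => 0 := by
  funext p
  rw [christoffel_inl α β hε hδ hφ0 hf0 hτ0]
  simp [partialDeriv_translationMetric_inl_inr, partialDeriv_translationMetric_inr_inl,
    partialDeriv_inr_translationMetric_inl_inl α β hφ0 hφ]

lemma christoffel_inl_inr_inl (k i : ι) (j : κ) :
    christoffel 𝔤 (Sum.inl k) (Sum.inr j) (Sum.inl i) = fun _ => 0 := by
  funext p
  rw [christoffel_inl α β hε hδ hφ0 hf0 hτ0]
  simp [partialDeriv_translationMetric_inr_inl,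
    partialDeriv_inr_translationMetric_inl_inl α β hφ0 hφ]

lemma christoffel_inl_inr_inr (k : ι) (i j : κ) :
    christoffel 𝔤 (Sum.inl k) (Sum.inr i) (Sum.inr j)
      = fun p => -((if i = j then δ i else 0) * (ε k * α k)) *
        ((fun s => logDeriv f s * f s ^ 2 * φ s ^ 2) (linFun α (baseProj p))
          * (fun t => (τ t ^ 2)⁻¹) (linFun β (fiberProj p))) := by
  funext p
  rw [christoffel_inl α β hε hδ hφ0 hf0 hτ0]
  simp only [partialDeriv_translationMetric_inr_inl,
    partialDeriv_inl_translationMetric_inr_inr α β hτ0 hf hτ]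
  ring

lemma christoffel_inr_inl_inl (k : κ) (i j : ι) :
    christoffel 𝔤 (Sum.inr k) (Sum.inl i) (Sum.inl j) = fun _ => 0 := by
  funext p
  rw [christoffel_inr α β hε hδ hφ0 hf0 hτ0]
  simp [partialDeriv_translationMetric_inl_inr,
    partialDeriv_inr_translationMetric_inl_inl α β hφ0 hφ]

lemma christoffel_inr_inl_inr (k j : κ) (i : ι) :
    christoffel 𝔤 (Sum.inr k) (Sum.inl i) (Sum.inr j)
      = fun p => ((if j = k then 1 else 0) * α i) * logDeriv f (linFun α (baseProj p)) := by
  funext p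
  have h1 := hf0 (linFun α (baseProj p))
  have h2 := hτ0 (linFun β (fiberProj p))
  rw [christoffel_inr α β hε hδ hφ0 hf0 hτ0]
  simp only [partialDeriv_translationMetric_inl_inr,
    partialDeriv_inl_translationMetric_inr_inr α β hτ0 hf hτ]
  by_cases h : j = k
  · subst h
    simp only [if_true]
    field_simp
    linear_combination (2 * f (linFun α (baseProj p)) ^ 2 * α i * logDeriv f (linFun α (baseProj p))) * hδ j
  · simp [h]

lemma christoffel_inr_inr_inl (k j : κ) (i : ι) :
    christoffel 𝔤 (Sum.inr k) (Sum.inr j) (Sum.inl i)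
      = fun p => ((if j = k then 1 else 0) * α i) * logDeriv f (linFun α (baseProj p)) := by
  funext p
  -- Symmetry in the lower indices: the two formulas differ only in the order of terms and in mixed
  -- metric components, whose derivatives vanish.
  have := congrFun (christoffel_inr_inl_inr α β hε hδ hφ0 hf0 hτ0 hφ hf hτ k j i) p
  rw [christoffel_inr α β hε hδ hφ0 hf0 hτ0] at this ⊢
  rw [← this]
  simp only [partialDeriv_translationMetric_inl_inr, partialDeriv_translationMetric_inr_inl]
  ring

lemma christoffel_inr_inr_inr (k i j : κ) :
    christoffel 𝔤 (Sum.inr k) (Sum.inr i) (Sum.inr j)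
      = fun p => -conformalSymbol δ β k i j * logDeriv τ (linFun β (fiberProj p)) := by
  funext p
  have h0 : (f (linFun α (baseProj p)) ^ 2)⁻¹ * τ (linFun β (fiberProj p)) ^ 2
      * (f (linFun α (baseProj p)) ^ 2 * (τ (linFun β (fiberProj p)) ^ 2)⁻¹) = 1 := by
    have h1 := hf0 (linFun α (baseProj p))
    have h2 := hτ0 (linFun β (fiberProj p))
    field_simp
  rw [christoffel_inr α β hε hδ hφ0 hf0 hτ0, conformalSymbol]
  simp only [partialDeriv_inr_translationMetric_inr_inr α β hτ0 hf hτ]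
  have e1 : ∀ l, (if l = k then δ l else 0) = (if l = k then 1 else 0) * δ k := by
    intro l; split_ifs with h <;> simp [h]
  have e2 : ∀ (l m : κ) (x : ℝ), (if l = m then x else 0) = (if l = m then 1 else 0) * x := by simp
  rw [e1, e1, e2 i j (δ i), e2 j k (β i), e2 i k (β j), e2 i j (δ k * δ i * β k)]
  linear_combination
    (-logDeriv τ (linFun β (fiberProj p)) * δ k * ((if j = k then 1 else 0) * δ k * β i
      + (if i = k then 1 else 0) * δ k * β j - (if i = j then 1 else 0) * δ i * β k)) * h0
    - logDeriv τ (linFun β (fiberProj p)) * ((if j = k then 1 else 0) * β i + (if i = k then 1 else 0) * β j) * hδ k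

end Connection

/-- Isolates the traces Γⁱᵢₚ, which are the derivatives of log √|det g| and therefore much simpler
than the individual symbols. -/
lemma ricci_eq_sum {ι : Type*} [Fintype ι] [DecidableEq ι] (g : (ι → ℝ) → Matrix ι ι ℝ)
    (j k : ι) (x : ι → ℝ) :
    ricci g j k x = ∑ i, partialDeriv i (christoffel g i j k) x
      - ∑ i, partialDeriv j (christoffel g i i k) x
      + ∑ p, (∑ i, christoffel g i i p x) * christoffel g p j k x
      - ∑ i, ∑ p, christoffel g i j p x * christoffel g p i k x := by
  simp only [ricci, riemann, Finset.sum_add_distrib, Finset.sum_sub_distrib, Finset.sum_mul]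
  rw [Finset.sum_comm (f := fun i p => christoffel g i i p x * christoffel g p j k x)]
  ring

/-! ### The Ricci tensor, block by block -/

section Ricci

variable {ι κ : Type*} [DecidableEq ι] [DecidableEq κ] [Fintype ι] [Fintype κ]
  {ε : ι → ℝ} (α : ι → ℝ) {δ : κ → ℝ} (β : κ → ℝ) {φ f τ : ℝ → ℝ}

local notation "𝔤" => translationMetric ε α δ β φ f τ

lemma contDiff_logDeriv {F : ℝ → ℝ} (hF : ContDiff ℝ ∞ F) (h0 : ∀ s, F s ≠ 0) :
    ContDiff ℝ ∞ (logDeriv F) :=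
  (contDiff_infty_iff_deriv.1 hF).2.div hF h0

variable (hε : ∀ i, ε i * ε i = 1) (hδ : ∀ i, δ i * δ i = 1)
  (hφ0 : ∀ s, φ s ≠ 0) (hf0 : ∀ s, f s ≠ 0) (hτ0 : ∀ s, τ s ≠ 0)
  (hφ : ContDiff ℝ ∞ φ) (hf : ContDiff ℝ ∞ f) (hτ : ContDiff ℝ ∞ τ)

include hε hδ hφ0 hf0 hτ0 hφ hf hτ

local notation "dφ" => ContDiff.differentiable hφ (by simp)
local notation "df" => ContDiff.differentiable hf (by simp)
local notation "dτ" => ContDiff.differentiable hτ (by simp)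

lemma sum_christoffel_self_inl (j : ι) (p : ι ⊕ κ → ℝ) :
    ∑ A, christoffel 𝔤 A A (Sum.inl j) p
      = (Fintype.card κ * logDeriv f (linFun α (baseProj p))
        - Fintype.card ι * logDeriv φ (linFun α (baseProj p))) * α j := by
  simp only [Fintype.sum_sum_type, christoffel_inl_inl_inl α β hε hδ hφ0 hf0 hτ0 dφ df dτ,
    christoffel_inr_inr_inl α β hε hδ hφ0 hf0 hτ0 dφ df dτ, neg_mul, Finset.sum_neg_distrib,
    ← Finset.sum_mul, sum_conformalSymbol_self ε α hε]
  simp [Finset.card_univ]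
  ring

lemma sum_christoffel_self_inr (j : κ) (p : ι ⊕ κ → ℝ) :
    ∑ A, christoffel 𝔤 A A (Sum.inr j) p
      = -(Fintype.card κ * logDeriv τ (linFun β (fiberProj p))) * β j := by
  simp only [Fintype.sum_sum_type, christoffel_inl_inl_inr α β hε hδ hφ0 hf0 hτ0 dφ df dτ,
    christoffel_inr_inr_inr α β hε hδ hφ0 hf0 hτ0 dφ df dτ, neg_mul, Finset.sum_neg_distrib,
    ← Finset.sum_mul, sum_conformalSymbol_self δ β hδ]
  simp
  ring

lemma ricci_inl_inl (j k : ι) (p : ι ⊕ κ → ℝ) :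
    ricci 𝔤 (Sum.inl j) (Sum.inl k) p =
      (((Fintype.card ι : ℝ) - 2) * (deriv (logDeriv φ) (linFun α (baseProj p))
          + logDeriv φ (linFun α (baseProj p)) ^ 2)
        - Fintype.card κ * (deriv (logDeriv f) (linFun α (baseProj p))
          + logDeriv f (linFun α (baseProj p)) ^ 2
          + 2 * (logDeriv φ (linFun α (baseProj p)) * logDeriv f (linFun α (baseProj p)))))
        * (α j * α k)
      + (deriv (logDeriv φ) (linFun α (baseProj p))
          - ((Fintype.card ι : ℝ) - 2) * logDeriv φ (linFun α (baseProj p)) ^ 2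
          + Fintype.card κ * (logDeriv φ (linFun α (baseProj p)) * logDeriv f (linFun α (baseProj p))))
        * (if j = k then ε j * sqNorm ε α else 0) := by
  have hLφ := (contDiff_logDeriv hφ hφ0).differentiable (by simp)
  have hLf := (contDiff_logDeriv hf hf0).differentiable (by simp)
  have t1 : ∑ A, partialDeriv A (christoffel 𝔤 A (Sum.inl j) (Sum.inl k)) p
      = -(deriv (logDeriv φ) (linFun α (baseProj p)) * ∑ i, α i * conformalSymbol ε α i j k) := by
    simp only [Fintype.sum_sum_type, christoffel_inl_inl_inl α β hε hδ hφ0 hf0 hτ0 dφ df dτ,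
      christoffel_inr_inl_inl α β hε hδ hφ0 hf0 hτ0 dφ df dτ, partialDeriv_const,
      partialDeriv_inl_base α hLφ, Finset.sum_const_zero, add_zero, Finset.mul_sum,
      ← Finset.sum_neg_distrib]
    exact Finset.sum_congr rfl fun i _ => by ring
  have t2 : ∑ A, partialDeriv (Sum.inl j) (christoffel 𝔤 A A (Sum.inl k)) p
      = -(∑ i, conformalSymbol ε α i i k) * (α j * deriv (logDeriv φ) (linFun α (baseProj p)))
        + Fintype.card κ * (α j * α k * deriv (logDeriv f) (linFun α (baseProj p))) := by
    simp only [Fintype.sum_sum_type, christoffel_inl_inl_inl α β hε hδ hφ0 hf0 hτ0 dφ df dτ,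
      christoffel_inr_inr_inl α β hε hδ hφ0 hf0 hτ0 dφ df dτ,
      partialDeriv_inl_base α hLφ, partialDeriv_inl_base α hLf, ← Finset.sum_neg_distrib,
      Finset.sum_mul]
    simp
    left
    ring
  have t3 : ∑ A, (∑ B, christoffel 𝔤 B B A p) * christoffel 𝔤 A (Sum.inl j) (Sum.inl k) p
      = -(logDeriv φ (linFun α (baseProj p)) * (Fintype.card κ * logDeriv f (linFun α (baseProj p))
        - Fintype.card ι * logDeriv φ (linFun α (baseProj p))))
        * ∑ i, α i * conformalSymbol ε α i j k := by
    -- The pattern splits only the outer sum, keeping the inner trace intact for the trace lemmas.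
    simp only [Fintype.sum_sum_type (f := fun A => (∑ B, _) * _),
      sum_christoffel_self_inl α β hε hδ hφ0 hf0 hτ0 hφ hf hτ,
      sum_christoffel_self_inr α β hε hδ hφ0 hf0 hτ0 hφ hf hτ,
      christoffel_inl_inl_inl α β hε hδ hφ0 hf0 hτ0 dφ df dτ,
      christoffel_inr_inl_inl α β hε hδ hφ0 hf0 hτ0 dφ df dτ, mul_zero,
      Finset.sum_const_zero, add_zero, Finset.mul_sum]
    exact Finset.sum_congr rfl fun i _ => by ring
  have t4 : ∑ A, ∑ B, christoffel 𝔤 A (Sum.inl j) B p * christoffel 𝔤 B A (Sum.inl k) p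
      = logDeriv φ (linFun α (baseProj p)) ^ 2
          * ∑ i, ∑ l, conformalSymbol ε α i j l * conformalSymbol ε α l i k
        + Fintype.card κ * (logDeriv f (linFun α (baseProj p)) ^ 2 * (α j * α k)) := by
    simp only [Fintype.sum_sum_type, christoffel_inl_inl_inl α β hε hδ hφ0 hf0 hτ0 dφ df dτ,
      christoffel_inl_inl_inr α β hε hδ hφ0 hf0 hτ0 dφ df dτ,
      christoffel_inr_inl_inl α β hε hδ hφ0 hf0 hτ0 dφ df dτ,
      christoffel_inr_inl_inr α β hε hδ hφ0 hf0 hτ0 dφ df dτ,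
      christoffel_inr_inr_inl α β hε hδ hφ0 hf0 hτ0 dφ df dτ, mul_zero, zero_mul,
      Finset.sum_const_zero, add_zero, zero_add, Finset.mul_sum]
    congr 1
    · exact Finset.sum_congr rfl fun i _ => Finset.sum_congr rfl fun l _ => by ring
    · simp
      left
      ring
  rw [ricci_eq_sum, t1, t2, t3, t4, sum_mul_conformalSymbol, sum_conformalSymbol_mul ε α hε,
    sum_conformalSymbol_self ε α hε]
  ring

/-- The derivative terms vanish because each differentiates a function of one linear coordinate
along the other factor. The trace term and the quadratic term both equal -m (f'/f)(τ'/τ) αⱼ βₖ and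
cancel. -/
lemma ricci_inl_inr (j : ι) (k : κ) (p : ι ⊕ κ → ℝ) :
    ricci 𝔤 (Sum.inl j) (Sum.inr k) p = 0 := by
  have hLf := (contDiff_logDeriv hf hf0).differentiable (by simp)
  have hLτ := (contDiff_logDeriv hτ hτ0).differentiable (by simp)
  rw [ricci_eq_sum]
  simp only [Fintype.sum_sum_type (f := fun A => (∑ B, _) * _),
    sum_christoffel_self_inl α β hε hδ hφ0 hf0 hτ0 hφ hf hτ,
    sum_christoffel_self_inr α β hε hδ hφ0 hf0 hτ0 hφ hf hτ]
  simp only [Fintype.sum_sum_type,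
      christoffel_inl_inl_inr α β hε hδ hφ0 hf0 hτ0 dφ df dτ,
      christoffel_inl_inr_inr α β hε hδ hφ0 hf0 hτ0 dφ df dτ,
      christoffel_inr_inl_inl α β hε hδ hφ0 hf0 hτ0 dφ df dτ,
      christoffel_inr_inl_inr α β hε hδ hφ0 hf0 hτ0 dφ df dτ,
      christoffel_inr_inr_inr α β hε hδ hφ0 hf0 hτ0 dφ df dτ, mul_zero, zero_mul,
      partialDeriv_const, partialDeriv_inr_base α hLf, partialDeriv_inl_fiber β hLτ,
      Finset.sum_const_zero, add_zero, zero_add, sub_zero]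
  have h : ∑ x, ∑ y, (if y = x then 1 else 0) * α j * logDeriv f (linFun α (baseProj p)) *
      (-conformalSymbol δ β y x k * logDeriv τ (linFun β (fiberProj p)))
      = -(α j * logDeriv f (linFun α (baseProj p)) * logDeriv τ (linFun β (fiberProj p)))
        * ∑ x, conformalSymbol δ β x x k := by
    rw [Finset.mul_sum]
    refine Finset.sum_congr rfl fun x _ => ?_
    simp
    ring
  rw [h, sum_conformalSymbol_self δ β hδ]
  simp
  ring

lemma ricci_inr_inl (j : ι) (k : κ) (p : ι ⊕ κ → ℝ) :
    ricci 𝔤 (Sum.inr k) (Sum.inl j) p = 0 := by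
  have hLφ := (contDiff_logDeriv hφ hφ0).differentiable (by simp)
  have hLf := (contDiff_logDeriv hf hf0).differentiable (by simp)
  rw [ricci_eq_sum]
  simp only [Fintype.sum_sum_type (f := fun A => (∑ B, _) * _),
    sum_christoffel_self_inl α β hε hδ hφ0 hf0 hτ0 hφ hf hτ,
    sum_christoffel_self_inr α β hε hδ hφ0 hf0 hτ0 hφ hf hτ]
  simp only [Fintype.sum_sum_type,
      christoffel_inl_inl_inl α β hε hδ hφ0 hf0 hτ0 dφ df dτ,
      christoffel_inl_inr_inl α β hε hδ hφ0 hf0 hτ0 dφ df dτ,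
      christoffel_inl_inr_inr α β hε hδ hφ0 hf0 hτ0 dφ df dτ,
      christoffel_inr_inl_inl α β hε hδ hφ0 hf0 hτ0 dφ df dτ,
      christoffel_inr_inr_inl α β hε hδ hφ0 hf0 hτ0 dφ df dτ,
      christoffel_inr_inr_inr α β hε hδ hφ0 hf0 hτ0 dφ df dτ, mul_zero, zero_mul,
      partialDeriv_const, partialDeriv_inr_base α hLf, partialDeriv_inr_base α hLφ,
      Finset.sum_const_zero, add_zero, zero_add, sub_zero]
  have h : ∑ x, ∑ y, -conformalSymbol δ β x k y * logDeriv τ (linFun β (fiberProj p)) *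
      ((if x = y then 1 else 0) * α j * logDeriv f (linFun α (baseProj p)))
      = -(α j * logDeriv f (linFun α (baseProj p)) * logDeriv τ (linFun β (fiberProj p)))
        * ∑ x, conformalSymbol δ β x x k := by
    rw [Finset.mul_sum]
    refine Finset.sum_congr rfl fun x _ => ?_
    simp [conformalSymbol_comm δ β x k x]
    ring
  rw [h, sum_conformalSymbol_self δ β hδ]
  simp
  ring

lemma ricci_inr_inr (j k : κ) (p : ι ⊕ κ → ℝ) :
    ricci 𝔤 (Sum.inr j) (Sum.inr k) p =
      ((Fintype.card κ : ℝ) - 2) * (deriv (logDeriv τ) (linFun β (fiberProj p))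
          + logDeriv τ (linFun β (fiberProj p)) ^ 2) * (β j * β k)
      + (deriv (logDeriv τ) (linFun β (fiberProj p))
          - ((Fintype.card κ : ℝ) - 2) * logDeriv τ (linFun β (fiberProj p)) ^ 2)
        * (if j = k then δ j * sqNorm δ β else 0)
      - (deriv (fun s => logDeriv f s * f s ^ 2 * φ s ^ 2) (linFun α (baseProj p))
          + ((Fintype.card κ - 2) * logDeriv f (linFun α (baseProj p))
              - Fintype.card ι * logDeriv φ (linFun α (baseProj p)))
            * (logDeriv f (linFun α (baseProj p)) * f (linFun α (baseProj p)) ^ 2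
              * φ (linFun α (baseProj p)) ^ 2))
        * (τ (linFun β (fiberProj p)) ^ 2)⁻¹ * sqNorm ε α * (if j = k then δ j else 0) := by
  have hLτ := (contDiff_logDeriv hτ hτ0).differentiable (by simp)
  -- This function is the s-dependent factor of the symbols with upper base index and lower fiber
  -- indices.
  have hQ : Differentiable ℝ (fun s => logDeriv f s * f s ^ 2 * φ s ^ 2) :=
    ((((contDiff_logDeriv hf hf0).mul (hf.pow 2)).mul (hφ.pow 2)).differentiable (by simp))
  have hR := differentiable_inv_sq dτ hτ0
  have t1 : ∑ A, partialDeriv A (christoffel 𝔤 A (Sum.inr j) (Sum.inr k)) p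
      = -(if j = k then δ j else 0) * sqNorm ε α
          * deriv (fun s => logDeriv f s * f s ^ 2 * φ s ^ 2) (linFun α (baseProj p))
          * (τ (linFun β (fiberProj p)) ^ 2)⁻¹
        -(deriv (logDeriv τ) (linFun β (fiberProj p)) * ∑ i, β i * conformalSymbol δ β i j k) := by
    simp only [Fintype.sum_sum_type, christoffel_inl_inr_inr α β hε hδ hφ0 hf0 hτ0 dφ df dτ,
      christoffel_inr_inr_inr α β hε hδ hφ0 hf0 hτ0 dφ df dτ,
      partialDeriv_inr_fiber β hLτ, partialDeriv_inl_mul α β hQ hR]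
    rw [sub_eq_add_neg]
    congr 1
    · simp only [sqNorm, Finset.mul_sum, Finset.sum_mul]
      exact Finset.sum_congr rfl fun i _ => by ring
    · simp only [Finset.mul_sum, ← Finset.sum_neg_distrib]
      exact Finset.sum_congr rfl fun i _ => by ring
  have t2 : ∑ A, partialDeriv (Sum.inr j) (christoffel 𝔤 A A (Sum.inr k)) p
      = -(∑ i, conformalSymbol δ β i i k) * (β j * deriv (logDeriv τ) (linFun β (fiberProj p))) := by
    simp only [Fintype.sum_sum_type, christoffel_inl_inl_inr α β hε hδ hφ0 hf0 hτ0 dφ df dτ,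
      christoffel_inr_inr_inr α β hε hδ hφ0 hf0 hτ0 dφ df dτ, partialDeriv_const,
      partialDeriv_inr_fiber β hLτ, ← Finset.sum_neg_distrib, Finset.sum_mul,
      Finset.sum_const_zero, zero_add]
  have t3 : ∑ A, (∑ B, christoffel 𝔤 B B A p) * christoffel 𝔤 A (Sum.inr j) (Sum.inr k) p
      = -((Fintype.card κ * logDeriv f (linFun α (baseProj p))
        - Fintype.card ι * logDeriv φ (linFun α (baseProj p)))) * sqNorm ε α
          * (if j = k then δ j else 0) * (logDeriv f (linFun α (baseProj p))
              * f (linFun α (baseProj p)) ^ 2 * φ (linFun α (baseProj p)) ^ 2)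
            * (τ (linFun β (fiberProj p)) ^ 2)⁻¹
        + Fintype.card κ * logDeriv τ (linFun β (fiberProj p)) ^ 2
          * ∑ i, β i * conformalSymbol δ β i j k := by
    simp only [Fintype.sum_sum_type (f := fun A => (∑ B, _) * _),
      sum_christoffel_self_inl α β hε hδ hφ0 hf0 hτ0 hφ hf hτ,
      sum_christoffel_self_inr α β hε hδ hφ0 hf0 hτ0 hφ hf hτ,
      christoffel_inl_inr_inr α β hε hδ hφ0 hf0 hτ0 dφ df dτ,
      christoffel_inr_inr_inr α β hε hδ hφ0 hf0 hτ0 dφ df dτ]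
    congr 1
    · simp only [sqNorm, Finset.mul_sum, Finset.sum_mul]
      exact Finset.sum_congr rfl fun i _ => by ring
    · rw [Finset.mul_sum]
      exact Finset.sum_congr rfl fun i _ => by ring
  have t4 : ∑ A, ∑ B, christoffel 𝔤 A (Sum.inr j) B p * christoffel 𝔤 B A (Sum.inr k) p
      = logDeriv τ (linFun β (fiberProj p)) ^ 2
          * ∑ i, ∑ l, conformalSymbol δ β i j l * conformalSymbol δ β l i k
        - 2 * (logDeriv f (linFun α (baseProj p)) * (logDeriv f (linFun α (baseProj p))
              * f (linFun α (baseProj p)) ^ 2 * φ (linFun α (baseProj p)) ^ 2)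
            * (τ (linFun β (fiberProj p)) ^ 2)⁻¹ * (if j = k then δ j else 0) * sqNorm ε α) := by
    simp only [Fintype.sum_sum_type,
      christoffel_inl_inl_inr α β hε hδ hφ0 hf0 hτ0 dφ df dτ,
      christoffel_inl_inr_inl α β hε hδ hφ0 hf0 hτ0 dφ df dτ,
      christoffel_inl_inr_inr α β hε hδ hφ0 hf0 hτ0 dφ df dτ,
      christoffel_inr_inl_inr α β hε hδ hφ0 hf0 hτ0 dφ df dτ,
      christoffel_inr_inr_inl α β hε hδ hφ0 hf0 hτ0 dφ df dτ,
      christoffel_inr_inr_inr α β hε hδ hφ0 hf0 hτ0 dφ df dτ, mul_zero,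
      Finset.sum_const_zero, zero_add, Finset.sum_add_distrib]
    -- The base-fiber and fiber-base parts of the double sum contribute the same amount, which
    -- accounts for the coefficient 2.
    have e1 : ∀ x : ι, ∑ y : κ, -((if j = y then δ j else 0) * (ε x * α x)) *
        (logDeriv f (linFun α (baseProj p)) * f (linFun α (baseProj p)) ^ 2
          * φ (linFun α (baseProj p)) ^ 2 * (τ (linFun β (fiberProj p)) ^ 2)⁻¹) *
        ((if k = y then 1 else 0) * α x * logDeriv f (linFun α (baseProj p)))
        = -(logDeriv f (linFun α (baseProj p)) * (logDeriv f (linFun α (baseProj p))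
              * f (linFun α (baseProj p)) ^ 2 * φ (linFun α (baseProj p)) ^ 2)
            * (τ (linFun β (fiberProj p)) ^ 2)⁻¹ * (if j = k then δ j else 0)) * (ε x * α x ^ 2) := by
      intro x
      rw [Finset.sum_eq_single k]
      · simp only [if_true]; ring
      · intro y _ hy; simp [hy.symm]
      · simp
    have e2 : ∀ (x : ι) (y : κ), (if j = y then 1 else 0) * α x * logDeriv f (linFun α (baseProj p)) *
        (-((if y = k then δ y else 0) * (ε x * α x)) *
        (logDeriv f (linFun α (baseProj p)) * f (linFun α (baseProj p)) ^ 2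
          * φ (linFun α (baseProj p)) ^ 2 * (τ (linFun β (fiberProj p)) ^ 2)⁻¹))
        = if j = y then -(logDeriv f (linFun α (baseProj p)) * (logDeriv f (linFun α (baseProj p))
              * f (linFun α (baseProj p)) ^ 2 * φ (linFun α (baseProj p)) ^ 2)
            * (τ (linFun β (fiberProj p)) ^ 2)⁻¹ * (if j = k then δ j else 0)) * (ε x * α x ^ 2) else 0 := by
      intro x y
      by_cases h : j = y
      · subst h; simp only [if_true]; ring
      · simp [h]
    rw [Finset.sum_congr rfl fun x _ => e1 x, Finset.sum_comm (s := (Finset.univ : Finset κ)) (t := (Finset.univ : Finset ι))]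
    simp only [e2, Finset.sum_ite_eq, Finset.mem_univ, if_true, ← Finset.mul_sum]
    rw [← sqNorm]
    have e3 : ∀ x y, -conformalSymbol δ β x j y * logDeriv τ (linFun β (fiberProj p))
        * (-conformalSymbol δ β y x k * logDeriv τ (linFun β (fiberProj p)))
        = logDeriv τ (linFun β (fiberProj p)) ^ 2
          * (conformalSymbol δ β x j y * conformalSymbol δ β y x k) := by
      intro x y; ring
    simp only [e3, ← Finset.mul_sum]
    ring
  rw [ricci_eq_sum, t1, t2, t3, t4, sum_mul_conformalSymbol, sum_conformalSymbol_mul δ β hδ,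
    sum_conformalSymbol_self δ β hδ]
  ring

end Ricci

/-! ### Linear coordinates and separation of coefficients -/

lemma contDiff_linFun {ι : Type*} [Fintype ι] (a : ι → ℝ) : ContDiff ℝ ∞ (linFun a) := by
  unfold linFun
  fun_prop

lemma contDiff_baseProj {ι κ : Type*} [Fintype ι] [Fintype κ] :
    ContDiff ℝ ∞ (baseProj : (ι ⊕ κ → ℝ) → ι → ℝ) := by
  unfold baseProj
  fun_prop

lemma contDiff_fiberProj {ι κ : Type*} [Fintype ι] [Fintype κ] :
    ContDiff ℝ ∞ (fiberProj : (ι ⊕ κ → ℝ) → κ → ℝ) := by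
  unfold fiberProj
  fun_prop

lemma exists_linFun_eq {ι : Type*} [Fintype ι] [DecidableEq ι] {a : ι → ℝ} (ha : a ≠ 0) (s : ℝ) :
    ∃ x, linFun a x = s := by
  obtain ⟨i, hi⟩ := Function.ne_iff.1 ha
  refine ⟨Pi.single i (s / a i), ?_⟩
  simp only [Pi.zero_apply] at hi
  simp [linFun, Pi.single_apply]
  field_simp

lemma exists_linFun_baseProj_fiberProj_eq {ι κ : Type*} [Fintype ι] [DecidableEq ι] [Fintype κ]
    [DecidableEq κ] {a : ι → ℝ} (ha : a ≠ 0) {b : κ → ℝ} (hb : b ≠ 0) (s t : ℝ) :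
    ∃ p : ι ⊕ κ → ℝ, linFun a (baseProj p) = s ∧ linFun b (fiberProj p) = t := by
  obtain ⟨x, hx⟩ := exists_linFun_eq ha s
  obtain ⟨y, hy⟩ := exists_linFun_eq hb t
  exact ⟨Sum.elim x y, hx, hy⟩

/-- In dimension at least two, a rank one form and a nondegenerate diagonal form are linearly
independent. -/
lemma mul_add_ite_eq_zero_iff {ι : Type*} [DecidableEq ι] [Nontrivial ι] {ε a : ι → ℝ}
    (hε : ∀ i, ε i * ε i = 1) (ha : a ≠ 0) (A B : ℝ) :
    (∀ i j, A * (a i * a j) + B * (if i = j then ε i else 0) = 0) ↔ A = 0 ∧ B = 0 := by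
  constructor
  · intro h
    obtain ⟨i, hi⟩ := Function.ne_iff.1 ha
    simp only [Pi.zero_apply] at hi
    obtain ⟨j, hj⟩ := exists_ne i
    have hεi : ∀ i, ε i ≠ 0 := fun i h0 => by simpa [h0] using hε i
    have hij := h i j
    have hii := h i i
    have hjj := h j j
    rw [if_neg hj.symm, mul_zero, add_zero] at hij
    rw [if_pos rfl] at hii hjj
    -- If A ≠ 0, the off-diagonal entry forces aⱼ = 0, the jj entry then gives B = 0, and the ii
    -- entry reads A aᵢ² = 0, a contradiction.
    by_cases hA : A = 0
    · refine ⟨hA, ?_⟩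
      rw [hA, zero_mul, zero_add] at hii
      exact (mul_eq_zero.1 hii).resolve_right (hεi i)
    · have haj : a j = 0 := by simpa [hA, hi] using hij
      rw [haj, mul_zero, mul_zero, zero_add] at hjj
      have hB := (mul_eq_zero.1 hjj).resolve_right (hεi j)
      rw [hB, zero_mul, add_zero] at hii
      exact absurd hii (mul_ne_zero hA (mul_ne_zero hi hi))
  · rintro ⟨rfl, rfl⟩ i j
    simp

lemma deriv_logDeriv_eq {F : ℝ → ℝ} (hF : ContDiff ℝ ∞ F) (h0 : ∀ s, F s ≠ 0) (s : ℝ) :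
    deriv (logDeriv F) s = deriv (deriv F) s / F s - (deriv F s / F s) ^ 2 := by
  have h1 := (contDiff_infty_iff_deriv.1 hF).1 s
  have h2 := (contDiff_infty_iff_deriv.1 (contDiff_infty_iff_deriv.1 hF).2).1 s
  have h := (h2.hasDerivAt.div h1.hasDerivAt (h0 s)).deriv
  rw [show logDeriv F = deriv F / F from rfl, h]
  have := h0 s
  field_simp

/-! ### Hessians, tension field and the soliton equations -/

section Soliton

variable {ι κ : Type*} [DecidableEq ι] [DecidableEq κ] [Fintype ι] [Fintype κ]
  {ε : ι → ℝ} (α : ι → ℝ) {δ : κ → ℝ} (β : κ → ℝ) {φ f τ h u : ℝ → ℝ}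

local notation "𝔤" => translationMetric ε α δ β φ f τ

section Functions

variable (F : ℝ → ℝ) (hF : Differentiable ℝ F)

include hF

lemma partialDeriv_inl_comp_base (i : ι) :
    partialDeriv (Sum.inl i) (fun p : ι ⊕ κ → ℝ => F (linFun α (baseProj p)))
      = fun p => α i * deriv F (linFun α (baseProj p)) := by
  funext p
  simpa using partialDeriv_inl_base α hF i 1 p

lemma partialDeriv_inr_comp_base (j : κ) :
    partialDeriv (Sum.inr j) (fun p : ι ⊕ κ → ℝ => F (linFun α (baseProj p))) = fun _ => 0 := by
  funext p
  simpa using partialDeriv_inr_base α hF j 1 p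

lemma partialDeriv_inl_comp_fiber (i : ι) :
    partialDeriv (Sum.inl i) (fun p : ι ⊕ κ → ℝ => F (linFun β (fiberProj p))) = fun _ => 0 := by
  funext p
  simpa using partialDeriv_inl_fiber β hF i 1 p

lemma partialDeriv_inr_comp_fiber (j : κ) :
    partialDeriv (Sum.inr j) (fun p : ι ⊕ κ → ℝ => F (linFun β (fiberProj p)))
      = fun p => β j * deriv F (linFun β (fiberProj p)) := by
  funext p
  simpa using partialDeriv_inr_fiber β hF j 1 p

end Functions

variable (hε : ∀ i, ε i * ε i = 1) (hδ : ∀ i, δ i * δ i = 1)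
  (hφ0 : ∀ s, φ s ≠ 0) (hf0 : ∀ s, f s ≠ 0) (hτ0 : ∀ s, τ s ≠ 0)
  (hφ : ContDiff ℝ ∞ φ) (hf : ContDiff ℝ ∞ f) (hτ : ContDiff ℝ ∞ τ)
  (hh : ContDiff ℝ ∞ h) (hu : ContDiff ℝ ∞ u)

include hε hδ hφ0 hf0 hτ0 hφ hf hτ

lemma isSemiRiemannianMetric_translationMetric : IsSemiRiemannianMetric 𝔤 where
  smooth A B := by
    have e1 : ContDiff ℝ ∞ (fun p : ι ⊕ κ → ℝ => linFun α (baseProj p)) :=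
      (contDiff_linFun α).comp contDiff_baseProj
    have e2 : ContDiff ℝ ∞ (fun p : ι ⊕ κ → ℝ => linFun β (fiberProj p)) :=
      (contDiff_linFun β).comp contDiff_fiberProj
    rcases A with i | i <;> rcases B with j | j
    · simp only [translationMetric_inl_inl]
      exact contDiff_const.mul (((hφ.comp e1).pow 2).inv fun p => pow_ne_zero 2 (hφ0 _))
    · simpa only [translationMetric_inl_inr] using contDiff_const
    · simpa only [translationMetric_inr_inl] using contDiff_const
    · simp only [translationMetric_inr_inr]
      exact contDiff_const.mul (((hf.comp e1).pow 2).mul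
        (((hτ.comp e2).pow 2).inv fun p => pow_ne_zero 2 (hτ0 _)))
  symm p := by
    ext A B
    rw [Matrix.transpose_apply]
    rcases A with i | i <;> rcases B with j | j
    · simp only [translationMetric_inl_inl]
      by_cases hij : i = j
      · rw [hij]
      · rw [if_neg hij, if_neg (Ne.symm hij)]
    · rw [translationMetric_inl_inr, translationMetric_inr_inl]
    · rw [translationMetric_inl_inr, translationMetric_inr_inl]
    · simp only [translationMetric_inr_inr]
      by_cases hij : i = j
      · rw [hij]
      · rw [if_neg hij, if_neg (Ne.symm hij)]
  nondegenerate p := (Matrix.isUnit_iff_isUnit_det _).1 (IsUnit.of_mul_eq_one _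
    (translationMetric_mul_inverse α β hε hδ hφ0 hf0 hτ0 p))

local notation "dφ" => ContDiff.differentiable hφ (by simp)
local notation "df" => ContDiff.differentiable hf (by simp)
local notation "dτ" => ContDiff.differentiable hτ (by simp)

section Hessians

variable {F : ℝ → ℝ} (hF : ContDiff ℝ ∞ F)

include hF

lemma hess_inl_inl_comp_base (i j : ι) (p : ι ⊕ κ → ℝ) :
    hess 𝔤 (fun p => F (linFun α (baseProj p))) (Sum.inl i) (Sum.inl j) p
      = (deriv (deriv F) (linFun α (baseProj p)) + 2 * logDeriv φ (linFun α (baseProj p))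
          * deriv F (linFun α (baseProj p))) * (α i * α j)
        - logDeriv φ (linFun α (baseProj p)) * deriv F (linFun α (baseProj p))
          * (if i = j then ε i * sqNorm ε α else 0) := by
  have d1 := (contDiff_infty_iff_deriv.1 hF).1
  have d2 := (contDiff_infty_iff_deriv.1 (contDiff_infty_iff_deriv.1 hF).2).1
  have t : ∑ k, -conformalSymbol ε α k i j * logDeriv φ (linFun α (baseProj p))
        * (α k * deriv F (linFun α (baseProj p)))
      = -(logDeriv φ (linFun α (baseProj p)) * deriv F (linFun α (baseProj p)))
        * ∑ k, α k * conformalSymbol ε α k i j := by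
    rw [Finset.mul_sum]
    exact Finset.sum_congr rfl fun k _ => by ring
  simp only [hess, Fintype.sum_sum_type, partialDeriv_inl_comp_base α F d1,
    partialDeriv_inr_comp_base α F d1, partialDeriv_inl_base α d2, mul_zero,
    Finset.sum_const_zero, add_zero, christoffel_inl_inl_inl α β hε hδ hφ0 hf0 hτ0 dφ df dτ, t,
    sum_mul_conformalSymbol]
  ring

lemma hess_inl_inr_comp_base (i : ι) (j : κ) (p : ι ⊕ κ → ℝ) :
    hess 𝔤 (fun p => F (linFun α (baseProj p))) (Sum.inl i) (Sum.inr j) p = 0 := by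
  have d1 := (contDiff_infty_iff_deriv.1 hF).1
  simp [hess, partialDeriv_const, partialDeriv_inr_comp_base α F d1,
    christoffel_inl_inl_inr α β hε hδ hφ0 hf0 hτ0 dφ df dτ]

lemma hess_inr_inl_comp_base (i : ι) (j : κ) (p : ι ⊕ κ → ℝ) :
    hess 𝔤 (fun p => F (linFun α (baseProj p))) (Sum.inr j) (Sum.inl i) p = 0 := by
  have d1 := (contDiff_infty_iff_deriv.1 hF).1
  have d2 := (contDiff_infty_iff_deriv.1 (contDiff_infty_iff_deriv.1 hF).2).1
  simp [hess, partialDeriv_inl_comp_base α F d1, partialDeriv_inr_base α d2,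
    partialDeriv_inr_comp_base α F d1, christoffel_inl_inr_inl α β hε hδ hφ0 hf0 hτ0 dφ df dτ]

/-- A function on the base has a Hessian along the fiber only through the warping, via the symbols
with upper base index; this is the source of the h' term in the third equation. -/
lemma hess_inr_inr_comp_base (i j : κ) (p : ι ⊕ κ → ℝ) :
    hess 𝔤 (fun p => F (linFun α (baseProj p))) (Sum.inr i) (Sum.inr j) p
      = logDeriv f (linFun α (baseProj p)) * f (linFun α (baseProj p)) ^ 2
        * φ (linFun α (baseProj p)) ^ 2 * (τ (linFun β (fiberProj p)) ^ 2)⁻¹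
        * deriv F (linFun α (baseProj p)) * sqNorm ε α * (if i = j then δ i else 0) := by
  have d1 := (contDiff_infty_iff_deriv.1 hF).1
  simp only [hess, Fintype.sum_sum_type, partialDeriv_inl_comp_base α F d1, partialDeriv_const,
    partialDeriv_inr_comp_base α F d1, mul_zero, sqNorm, Finset.mul_sum, Finset.sum_mul,
    Finset.sum_const_zero, add_zero, christoffel_inl_inr_inr α β hε hδ hφ0 hf0 hτ0 dφ df dτ,
    zero_sub, ← Finset.sum_neg_distrib]
  exact Finset.sum_congr rfl fun k _ => by ring

lemma hess_inl_inl_comp_fiber (i j : ι) (p : ι ⊕ κ → ℝ) :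
    hess 𝔤 (fun p => F (linFun β (fiberProj p))) (Sum.inl i) (Sum.inl j) p = 0 := by
  have d1 := (contDiff_infty_iff_deriv.1 hF).1
  simp [hess, partialDeriv_const, partialDeriv_inl_comp_fiber β F d1,
    christoffel_inr_inl_inl α β hε hδ hφ0 hf0 hτ0 dφ df dτ]

lemma hess_inr_inr_comp_fiber (i j : κ) (p : ι ⊕ κ → ℝ) :
    hess 𝔤 (fun p => F (linFun β (fiberProj p))) (Sum.inr i) (Sum.inr j) p
      = (deriv (deriv F) (linFun β (fiberProj p)) + 2 * logDeriv τ (linFun β (fiberProj p))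
          * deriv F (linFun β (fiberProj p))) * (β i * β j)
        - logDeriv τ (linFun β (fiberProj p)) * deriv F (linFun β (fiberProj p))
          * (if i = j then δ i * sqNorm δ β else 0) := by
  have d1 := (contDiff_infty_iff_deriv.1 hF).1
  have d2 := (contDiff_infty_iff_deriv.1 (contDiff_infty_iff_deriv.1 hF).2).1
  have t : ∑ k, -conformalSymbol δ β k i j * logDeriv τ (linFun β (fiberProj p))
        * (β k * deriv F (linFun β (fiberProj p)))
      = -(logDeriv τ (linFun β (fiberProj p)) * deriv F (linFun β (fiberProj p)))
        * ∑ k, β k * conformalSymbol δ β k i j := by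
    rw [Finset.mul_sum]
    exact Finset.sum_congr rfl fun k _ => by ring
  simp only [hess, Fintype.sum_sum_type, partialDeriv_inl_comp_fiber β F d1,
    partialDeriv_inr_comp_fiber β F d1, partialDeriv_inr_fiber β d2, mul_zero,
    Finset.sum_const_zero, zero_add, christoffel_inr_inr_inr α β hε hδ hφ0 hf0 hτ0 dφ df dτ, t,
    sum_mul_conformalSymbol]
  ring

/-- Only fiber diagonal entries contribute. Tracing δⱼ‖β‖² gives m‖β‖² against the 2‖β‖² from β ⊗ β,
whence the coefficient m - 2; the warping enters only as f⁻². -/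
lemma tension_comp_fiber (p : ι ⊕ κ → ℝ) :
    tension 𝔤 (fun p => F (linFun β (fiberProj p))) p
      = (f (linFun α (baseProj p)) ^ 2)⁻¹ * ((τ (linFun β (fiberProj p)) ^ 2
          * deriv (deriv F) (linFun β (fiberProj p))
          - ((Fintype.card κ : ℝ) - 2) * τ (linFun β (fiberProj p))
            * deriv τ (linFun β (fiberProj p)) * deriv F (linFun β (fiberProj p)))
          * sqNorm δ β) := by
  have hd : ∀ A, ∑ B, (𝔤 p)⁻¹ A B * hess 𝔤 (fun p => F (linFun β (fiberProj p))) A B p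
      = (𝔤 p)⁻¹ A A * hess 𝔤 (fun p => F (linFun β (fiberProj p))) A A p := by
    intro A
    refine Fintype.sum_eq_single A fun B hB => ?_
    rw [translationMetric_inv α β hε hδ hφ0 hf0 hτ0, Matrix.diagonal_apply_ne' _ hB, zero_mul]
  have ht : ∀ j, δ j * ((f (linFun α (baseProj p)) ^ 2)⁻¹ * τ (linFun β (fiberProj p)) ^ 2)
        * ((deriv (deriv F) (linFun β (fiberProj p)) + 2 * logDeriv τ (linFun β (fiberProj p))
          * deriv F (linFun β (fiberProj p))) * (β j * β j)
        - logDeriv τ (linFun β (fiberProj p)) * deriv F (linFun β (fiberProj p))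
          * (δ j * sqNorm δ β))
      = (f (linFun α (baseProj p)) ^ 2)⁻¹ * τ (linFun β (fiberProj p)) ^ 2
        * (deriv (deriv F) (linFun β (fiberProj p)) + 2 * logDeriv τ (linFun β (fiberProj p))
          * deriv F (linFun β (fiberProj p))) * (δ j * β j ^ 2)
        - (f (linFun α (baseProj p)) ^ 2)⁻¹ * τ (linFun β (fiberProj p)) ^ 2
          * logDeriv τ (linFun β (fiberProj p)) * deriv F (linFun β (fiberProj p))
          * sqNorm δ β := by
    intro j
    linear_combination (-(f (linFun α (baseProj p)) ^ 2)⁻¹ * τ (linFun β (fiberProj p)) ^ 2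
          * logDeriv τ (linFun β (fiberProj p)) * deriv F (linFun β (fiberProj p))
          * sqNorm δ β) * hδ j
  rw [tension, Finset.sum_congr rfl fun A _ => hd A]
  simp only [translationMetric_inv α β hε hδ hφ0 hf0 hτ0, Fintype.sum_sum_type,
    Matrix.diagonal_apply_eq, hess_inl_inl_comp_fiber α β hε hδ hφ0 hf0 hτ0 hφ hf hτ hF,
    hess_inr_inr_comp_fiber α β hε hδ hφ0 hf0 hτ0 hφ hf hτ hF, mul_zero, Finset.sum_const_zero,
    zero_add, if_true, Sum.elim_inr, ht, Finset.sum_sub_distrib, ← Finset.mul_sum,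
    Finset.sum_const, Finset.card_univ, nsmul_eq_mul]
  rw [← sqNorm, logDeriv_apply]
  have h1 := hf0 (linFun α (baseProj p))
  have h2 := hτ0 (linFun β (fiberProj p))
  field_simp
  ring

end Hessians

include hh hu

lemma metricInner_grad_comp_fiber_grad_comp_base (p : ι ⊕ κ → ℝ) :
    metricInner 𝔤 p (grad 𝔤 (fun p => u (linFun β (fiberProj p))) p)
      (grad 𝔤 (fun p => h (linFun α (baseProj p))) p) = 0 := by
  have du := (contDiff_infty_iff_deriv.1 hu).1
  have dh := (contDiff_infty_iff_deriv.1 hh).1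
  have gu : ∀ i, grad 𝔤 (fun p => u (linFun β (fiberProj p))) p (Sum.inl i) = 0 := by
    intro i
    simp [grad, translationMetric_inv α β hε hδ hφ0 hf0 hτ0, Matrix.diagonal_apply,
      partialDeriv_inl_comp_fiber β u du]
  have gh : ∀ i, grad 𝔤 (fun p => h (linFun α (baseProj p))) p (Sum.inr i) = 0 := by
    intro i
    simp [grad, translationMetric_inv α β hε hδ hφ0 hf0 hτ0, Matrix.diagonal_apply,
      partialDeriv_inr_comp_base α h dh]
  simp [metricInner, Fintype.sum_sum_type, gu, gh, translationMetric_inr_inl]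

/-- The defect of the soliton equation is displayed as a combination of α ⊗ α and ε. The θ term
drops out because U is constant along the base. -/
lemma soliton_inl_inl (θ lam : ℝ) (i j : ι) (p : ι ⊕ κ → ℝ) (s : ℝ)
    (hs : linFun α (baseProj p) = s) :
    ricci 𝔤 (Sum.inl i) (Sum.inl j) p
        + hess 𝔤 (fun p => h (linFun α (baseProj p))) (Sum.inl i) (Sum.inl j) p
        - θ * (partialDeriv (Sum.inl i) (fun p => u (linFun β (fiberProj p))) p
          * partialDeriv (Sum.inl j) (fun p => u (linFun β (fiberProj p))) p)
        - lam * 𝔤 p (Sum.inl i) (Sum.inl j)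
      = (((Fintype.card ι : ℝ) - 2) * (deriv (deriv φ) s / φ s)
          - Fintype.card κ * (deriv (deriv f) s / f s)
          - 2 * Fintype.card κ * (deriv φ s / φ s) * (deriv f s / f s)
          + deriv (deriv h) s + 2 * (deriv φ s / φ s) * deriv h s) * (α i * α j)
        + ((deriv (deriv φ) s / φ s - ((Fintype.card ι : ℝ) - 1) * (deriv φ s / φ s) ^ 2
          + Fintype.card κ * (deriv φ s / φ s) * (deriv f s / f s)
          - (deriv φ s / φ s) * deriv h s) * sqNorm ε α - lam / (φ s) ^ 2)
          * (if i = j then ε i else 0) := by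
  have du := (contDiff_infty_iff_deriv.1 hu).1
  have e : (if i = j then ε i * sqNorm ε α else 0) = (if i = j then ε i else 0) * sqNorm ε α := by
    rw [ite_mul, zero_mul]
  rw [ricci_inl_inl α β hε hδ hφ0 hf0 hτ0 hφ hf hτ,
    hess_inl_inl_comp_base α β hε hδ hφ0 hf0 hτ0 hφ hf hτ hh, translationMetric_inl_inl,
    partialDeriv_inl_comp_fiber β u du, e, hs, deriv_logDeriv_eq hφ hφ0, deriv_logDeriv_eq hf hf0,
    logDeriv_apply, logDeriv_apply]
  ring

/-- With τ⁻² pulled out, the coefficient of δ is a function of t minus a function of s, which is the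
third equation; the coefficient of β ⊗ β involves t alone. -/
lemma soliton_inr_inr (θ lam : ℝ) (i j : κ) (p : ι ⊕ κ → ℝ) (s t : ℝ)
    (hs : linFun α (baseProj p) = s) (ht : linFun β (fiberProj p) = t) :
    ricci 𝔤 (Sum.inr i) (Sum.inr j) p
        + hess 𝔤 (fun p => h (linFun α (baseProj p))) (Sum.inr i) (Sum.inr j) p
        - θ * (partialDeriv (Sum.inr i) (fun p => u (linFun β (fiberProj p))) p
          * partialDeriv (Sum.inr j) (fun p => u (linFun β (fiberProj p))) p)
        - lam * 𝔤 p (Sum.inr i) (Sum.inr j)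
      = (((Fintype.card κ : ℝ) - 2) * (deriv (deriv τ) t / τ t) - θ * (deriv u t) ^ 2)
          * (β i * β j)
        + ((τ t ^ 2)⁻¹ * ((τ t * deriv (deriv τ) t
            - ((Fintype.card κ : ℝ) - 1) * (deriv τ t) ^ 2) * sqNorm δ β
          - ((deriv (deriv f) s * (φ s) ^ 2 * f s
            - ((Fintype.card ι : ℝ) - 2) * deriv φ s * φ s * f s * deriv f s
            + ((Fintype.card κ : ℝ) - 1) * (deriv f s) ^ 2 * (φ s) ^ 2
            - deriv f s * f s * (φ s) ^ 2 * deriv h s) * sqNorm ε α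
          + lam * (f s) ^ 2)))
          * (if i = j then δ i else 0) := by
  have du := (contDiff_infty_iff_deriv.1 hu).1
  have e : (if i = j then δ i * sqNorm δ β else 0) = (if i = j then δ i else 0) * sqNorm δ β := by
    rw [ite_mul, zero_mul]
  have hQ : deriv (fun s => logDeriv f s * f s ^ 2 * φ s ^ 2) s
      = (deriv (deriv f) s * f s + deriv f s ^ 2) * φ s ^ 2
        + 2 * f s * deriv f s * φ s * deriv φ s := by
    have hQ' : (fun s => logDeriv f s * f s ^ 2 * φ s ^ 2)
        = fun s => deriv f s * f s * φ s ^ 2 := by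
      funext s
      have := hf0 s
      rw [logDeriv_apply]
      field_simp
    have d1 := (contDiff_infty_iff_deriv.1 hf).1 s
    have d2 := (contDiff_infty_iff_deriv.1 (contDiff_infty_iff_deriv.1 hf).2).1 s
    have d3 := (contDiff_infty_iff_deriv.1 hφ).1 s
    rw [hQ', ((d2.hasDerivAt.fun_mul d1.hasDerivAt).fun_mul (d3.hasDerivAt.fun_pow 2)).deriv]
    push_cast
    ring
  have h1 := hf0 s
  have h2 := hτ0 t
  have h3 := hφ0 s
  rw [ricci_inr_inr α β hε hδ hφ0 hf0 hτ0 hφ hf hτ,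
    hess_inr_inr_comp_base α β hε hδ hφ0 hf0 hτ0 hφ hf hτ hh, translationMetric_inr_inr,
    partialDeriv_inr_comp_fiber β u du, partialDeriv_inr_comp_fiber β u du, e, hs, ht, hQ,
    deriv_logDeriv_eq hτ hτ0, logDeriv_apply, logDeriv_apply, logDeriv_apply]
  simp only [ht]
  -- The diagonal entry enters linearly and is treated as an opaque scalar while denominators are
  -- cleared.
  generalize (if i = j then δ i else 0) = D
  field_simp
  ring

/-- The Ricci-harmonic soliton equations on the warped product, as ordinary differential
equations. -/
lemma isGRHS_translationMetric_iff [Nontrivial ι] [Nontrivial κ] (hα : α ≠ 0) (hβ : β ≠ 0)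
    {θ lam : ℝ} (hθ : 0 ≤ θ) :
    IsGRHS 𝔤 (fun p => h (linFun α (baseProj p))) (fun p => u (linFun β (fiberProj p))) θ lam ↔
      ((∀ s : ℝ,
        ((Fintype.card ι : ℝ) - 2) * (deriv (deriv φ) s / φ s)
          - Fintype.card κ * (deriv (deriv f) s / f s)
          - 2 * Fintype.card κ * (deriv φ s / φ s) * (deriv f s / f s)
          + deriv (deriv h) s + 2 * (deriv φ s / φ s) * deriv h s = 0) ∧
      (∀ s : ℝ,
        (deriv (deriv φ) s / φ s - ((Fintype.card ι : ℝ) - 1) * (deriv φ s / φ s) ^ 2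
          + Fintype.card κ * (deriv φ s / φ s) * (deriv f s / f s)
          - (deriv φ s / φ s) * deriv h s) * sqNorm ε α = lam / (φ s) ^ 2) ∧
      (∀ s t : ℝ,
        (deriv (deriv f) s * (φ s) ^ 2 * f s
            - ((Fintype.card ι : ℝ) - 2) * deriv φ s * φ s * f s * deriv f s
            + ((Fintype.card κ : ℝ) - 1) * (deriv f s) ^ 2 * (φ s) ^ 2
            - deriv f s * f s * (φ s) ^ 2 * deriv h s) * sqNorm ε α
          + lam * (f s) ^ 2
        = (τ t * deriv (deriv τ) t - ((Fintype.card κ : ℝ) - 1) * (deriv τ t) ^ 2)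
          * sqNorm δ β) ∧
      (∀ t : ℝ,
        ((Fintype.card κ : ℝ) - 2) * (deriv (deriv τ) t / τ t) - θ * (deriv u t) ^ 2 = 0) ∧
      (∀ t : ℝ,
        ((τ t) ^ 2 * deriv (deriv u) t
          - ((Fintype.card κ : ℝ) - 2) * τ t * deriv τ t * deriv u t) * sqNorm δ β = 0)) := by
  have du := (contDiff_infty_iff_deriv.1 hu).1
  constructor
  · intro H
    -- The two conjuncts are filled in by unification with the coefficients in `soliton_inl_inl`;
    -- the fiber coordinate 0 is arbitrary, as these do not involve t.
    have hb : ∀ s, _ ∧ _ := fun s => by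
      obtain ⟨p, hs, -⟩ := exists_linFun_baseProj_fiberProj_eq hα hβ s 0
      exact (mul_add_ite_eq_zero_iff hε hα _ _).1 fun i j =>
        (soliton_inl_inl α β hε hδ hφ0 hf0 hτ0 hφ hf hτ hh hu θ lam i j p s hs).symm.trans
          (sub_eq_zero.2 (H.ricci_eq p (Sum.inl i) (Sum.inl j)))
    have hf' : ∀ s t, _ ∧ _ := fun s t => by
      obtain ⟨p, hs, ht⟩ := exists_linFun_baseProj_fiberProj_eq hα hβ s t
      exact (mul_add_ite_eq_zero_iff hδ hβ _ _).1 fun i j =>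
        (soliton_inr_inr α β hε hδ hφ0 hf0 hτ0 hφ hf hτ hh hu θ lam i j p s t hs ht).symm.trans
          (sub_eq_zero.2 (H.ricci_eq p (Sum.inr i) (Sum.inr j)))
    refine ⟨fun s => (hb s).1, fun s => sub_eq_zero.1 (hb s).2, fun s t => ?_,
      fun t => (hf' 0 t).1, fun t => ?_⟩
    -- The factor τ⁻² is nonzero and can be cancelled.
    · exact (sub_eq_zero.1 ((mul_eq_zero.1 (hf' s t).2).resolve_left
        (inv_ne_zero (pow_ne_zero 2 (hτ0 t))))).symm
    · obtain ⟨p, -, ht⟩ := exists_linFun_baseProj_fiberProj_eq hα hβ 0 t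
      have h5 := H.tension_eq p
      rw [metricInner_grad_comp_fiber_grad_comp_base α β hε hδ hφ0 hf0 hτ0 hφ hf hτ hh hu,
        tension_comp_fiber α β hε hδ hφ0 hf0 hτ0 hφ hf hτ hu, sub_zero, ht] at h5
      exact (mul_eq_zero.1 h5).resolve_left (inv_ne_zero (pow_ne_zero 2 (hf0 _)))
  · rintro ⟨h1, h2, h3, h4, h5⟩
    refine ⟨isSemiRiemannianMetric_translationMetric α β hε hδ hφ0 hf0 hτ0 hφ hf hτ,
      hh.comp ((contDiff_linFun α).comp contDiff_baseProj),
      hu.comp ((contDiff_linFun β).comp contDiff_fiberProj), hθ, fun p A B => ?_, fun p => ?_⟩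
    · rcases A with i | i <;> rcases B with j | j
      · rw [← sub_eq_zero,
          soliton_inl_inl α β hε hδ hφ0 hf0 hτ0 hφ hf hτ hh hu θ lam i j p _ rfl, h1, h2]
        ring
      · rw [ricci_inl_inr α β hε hδ hφ0 hf0 hτ0 hφ hf hτ,
          hess_inl_inr_comp_base α β hε hδ hφ0 hf0 hτ0 hφ hf hτ hh, translationMetric_inl_inr,
          partialDeriv_inl_comp_fiber β u du]
        ring
      · rw [ricci_inr_inl α β hε hδ hφ0 hf0 hτ0 hφ hf hτ,
          hess_inr_inl_comp_base α β hε hδ hφ0 hf0 hτ0 hφ hf hτ hh, translationMetric_inr_inl,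
          partialDeriv_inl_comp_fiber β u du]
        ring
      · rw [← sub_eq_zero,
          soliton_inr_inr α β hε hδ hφ0 hf0 hτ0 hφ hf hτ hh hu θ lam i j p _ _ rfl rfl, h3, h4]
        ring
    · rw [metricInner_grad_comp_fiber_grad_comp_base α β hε hδ hφ0 hf0 hτ0 hφ hf hτ hh hu,
        tension_comp_fiber α β hε hδ hφ0 hf0 hτ0 hφ hf hτ hu, h5]
      ring

end Soliton

end GRHS

end

/-! ### The theorem in dimensions n and m -/

theorem theorem4 (n m : ℕ) (hn : 2 ≤ n) (hm : 2 ≤ m)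
    (ε : Fin n → ℝ) (hε : ∀ i, ε i = 1 ∨ ε i = -1)
    (δ : Fin m → ℝ) (hδ : ∀ j, δ j = 1 ∨ δ j = -1)
    (α : Fin n → ℝ) (hα : α ≠ 0) (β : Fin m → ℝ) (hβ : β ≠ 0)
    (θ lam : ℝ) (hθ : 0 ≤ θ)
    (φ f h τ u : ℝ → ℝ)
    (hφ : ContDiff ℝ ∞ φ) (hφ0 : ∀ s, φ s ≠ 0)
    (hf : ContDiff ℝ ∞ f) (hf0 : ∀ s, 0 < f s)
    (hh : ContDiff ℝ ∞ h)
    (hτ : ContDiff ℝ ∞ τ) (hτ0 : ∀ t, τ t ≠ 0)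
    (hu : ContDiff ℝ ∞ u) :
    (GRHS.IsGRHS
        (GRHS.warpedMetric
          (GRHS.conformalMetric ε (fun x => φ (GRHS.linFun α x)))
          (fun x => f (GRHS.linFun α x))
          (GRHS.conformalMetric δ (fun y => τ (GRHS.linFun β y))))
        (fun p => h (GRHS.linFun α (GRHS.baseProj p)))
        (fun p => u (GRHS.linFun β (GRHS.fiberProj p)))
        θ lam ∧
      ¬ ∃ c : ℝ, ∀ p : Fin n ⊕ Fin m → ℝ, u (GRHS.linFun β (GRHS.fiberProj p)) = c)
    ↔
    ((¬ ∃ c : ℝ, ∀ t, u t = c) ∧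
      (∀ s : ℝ,
        ((n : ℝ) - 2) * (deriv (deriv φ) s / φ s) - m * (deriv (deriv f) s / f s)
          - 2 * m * (deriv φ s / φ s) * (deriv f s / f s)
          + deriv (deriv h) s + 2 * (deriv φ s / φ s) * deriv h s = 0) ∧
      (∀ s : ℝ,
        (deriv (deriv φ) s / φ s - ((n : ℝ) - 1) * (deriv φ s / φ s) ^ 2
          + m * (deriv φ s / φ s) * (deriv f s / f s)
          - (deriv φ s / φ s) * deriv h s) * GRHS.sqNorm ε α = lam / (φ s) ^ 2) ∧
      (∀ s t : ℝ,
        (deriv (deriv f) s * (φ s) ^ 2 * f s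
            - ((n : ℝ) - 2) * deriv φ s * φ s * f s * deriv f s
            + ((m : ℝ) - 1) * (deriv f s) ^ 2 * (φ s) ^ 2
            - deriv f s * f s * (φ s) ^ 2 * deriv h s) * GRHS.sqNorm ε α
          + lam * (f s) ^ 2
        = (τ t * deriv (deriv τ) t - ((m : ℝ) - 1) * (deriv τ t) ^ 2) * GRHS.sqNorm δ β) ∧
      (∀ t : ℝ,
        ((m : ℝ) - 2) * (deriv (deriv τ) t / τ t) - θ * (deriv u t) ^ 2 = 0) ∧
      (∀ t : ℝ,
        ((τ t) ^ 2 * deriv (deriv u) t - ((m : ℝ) - 2) * τ t * deriv τ t * deriv u t)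
          * GRHS.sqNorm δ β = 0)) := by
  have sq_one : ∀ x : ℝ, x = 1 ∨ x = -1 → x * x = 1 := by
    rintro x (rfl | rfl) <;> norm_num
  have : Nontrivial (Fin n) := Fin.nontrivial_iff_two_le.2 hn
  have : Nontrivial (Fin m) := Fin.nontrivial_iff_two_le.2 hm
  have key := GRHS.isGRHS_translationMetric_iff α β (fun i => sq_one _ (hε i))
    (fun j => sq_one _ (hδ j)) hφ0 (fun s => (hf0 s).ne') hτ0 hφ hf hτ hh hu hα hβ
    (lam := lam) hθ
  simp only [Fintype.card_fin] at key
  rw [and_comm, key]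
  -- It remains to match the two non-constancy conditions: ζ is onto ℝ since β ≠ 0, so U and u take
  -- the same values.
  refine and_congr_left fun _ => not_congr (exists_congr fun c => ⟨fun H t => ?_, fun H p => H _⟩)
  obtain ⟨p, -, rfl⟩ := GRHS.exists_linFun_baseProj_fiberProj_eq hα hβ 0 t
  exact H p
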